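/- Let $H$ and $U$ be complex Hilbert spaces and let $A:D(A)\subset H\to H$ be a self-adjoint operator that is strictly positive, i.e. $\langle Ax,x\rangle_H\ge m\|x\|_H^2$ on $D(A)$ for some $m>0$. Let $H_{1/2}=D(A^{1/2})$ with the norm $\|z\|_{1/2}=\|A^{1/2}z\|_H$, let $H_{-1/2}$ be its dual with respect to the pivot space $H$, and let $A:H_{1/2}\to H_{-1/2}$ also denote the bounded extension of $A$. Let $B:U\to H_{-1/2}$ be a bounded linear operator, with adjoint $B^*:H_{1/2}\to U$ ($U$ being identified with its dual). Let $0<\alpha<1$ and $\eta>0$, and put $$p(\xi)=|\xi|^{\frac{2\alpha-1}{2}}\ (\xi\in\mathbb R),\qquad \gamma=\frac{2\sin(\alpha\pi)\,\Gamma(\frac12+1)}{\pi^{\frac12+1}}.$$ On $\mathcal H=H_{1/2}\times H\times L^2(\mathbb R;U)$, with the inner product $\langle A^{1/2}u_1,A^{1/2}u_2\rangle_H+\langle v_1,v_2\rangle_H+\gamma\int_{\mathbb R}\langle\varphi_1(\xi),\varphi_2(\xi)\rangle_U\,d\xi$, let $$\mathcal A(u,v,\varphi)=\Big(v,\ -Au-\gamma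 B\int_{\mathbb R}p(\xi)\varphi(\xi)\,d\xi,\ -(|\xi|^2+\eta)\varphi+p(\xi)B^*v\Big)$$ with domain the set of all $(u,v,\varphi)\in\mathcal H$ such that $v\in H_{1/2}$, $Au+\gamma B\int_{\mathbb R}p(\xi)\varphi(\xi)\,d\xi\in H$, $|\xi|\varphi\in L^2(\mathbb R;U)$ and $-(|\xi|^2+\eta)\varphi+p(\xi)B^*v\in L^2(\mathbb R;U)$. On $\mathcal H_0=H_{1/2}\times H$ let $$\mathcal A_0(w,v)=(v,\,-Aw-BB^*v),\qquad D(\mathcal A_0)=\{(w,v)\in\mathcal H_0:\ v\in H_{1/2},\ Aw+BB^*v\in H\}.$$ Let $M:[0,\infty)\to\mathbb R$ be a nondecreasing function with $M(r)>0$ for $r\ge1$. Assume that $i\mathbb R\subset\rho(\mathcal A_0)$, that $$\limsup_{\omega\in\mathbb R,\ |\omega|\to\infty}\big\|M(|\omega|)^{-1}(i\omega I-\mathcal A_0)^{-1}\big\|_{\mathcal L(\mathcal H_0)}<\infty,$$ and that $i\mathbb R\subset\rho(\mathcal A)$. Then there exists a constant $C>0$ such that $$\|(i\omega I-\mathcal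 A)^{-1}\|_{\mathcal L(\mathcal H)}\le C\,|\omega|^{1-\alpha}M(|\omega|)\qquad\text{for all }\omega\ge1.$$ -/

import Mathlib

open MeasureTheory Set Filter
open scoped ComplexConjugate ENNReal

noncomputable section

namespace FracDamp

/-! ### Resolvents of unbounded operators -/

section Resolvent

variable {X : Type*} [NormedAddCommGroup X] [NormedSpace ℂ X]

/-- `R` is a bounded two-sided inverse of `z - T : D(T) → X`. -/
def IsResolventAt (T : X →ₗ.[ℂ] X) (z : ℂ) (R : X →L[ℂ] X) : Prop :=
  (∀ x : X, ∃ y : T.domain, (y : X) = R x ∧ z • (y : X) - T y = x) ∧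
    ∀ y : T.domain, R (z • (y : X) - T y) = y

/-- The resolvent set `ρ(T)`: all `z` such that `z - T : D(T) → X` is a bijection with
bounded inverse. -/
def resolventSet (T : X →ₗ.[ℂ] X) : Set ℂ := {z | ∃ R : X →L[ℂ] X, IsResolventAt T z R}

open Classical in
/-- The resolvent operator `(z - T)⁻¹ ∈ 𝓛(X)` for `z ∈ ρ(T)` (and `0` for other `z`). -/
def resolventOp (T : X →ₗ.[ℂ] X) (z : ℂ) : X →L[ℂ] X :=
  if h : z ∈ resolventSet T then h.choose else 0

theorem IsResolventAt.unique {T : X →ₗ.[ℂ] X} {z : ℂ} {R R' : X →L[ℂ] X}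
    (h : IsResolventAt T z R) (h' : IsResolventAt T z R') : R = R' := by
  ext x
  obtain ⟨y, hy, hyx⟩ := h'.1 x
  have := h.2 y
  rw [hyx] at this
  rw [this, hy]

theorem isResolventAt_resolventOp {T : X →ₗ.[ℂ] X} {z : ℂ} (h : z ∈ resolventSet T) :
    IsResolventAt T z (resolventOp T z) := by
  rw [resolventOp, dif_pos h]
  exact h.choose_spec

end Resolvent

/-! ### Strictly positive self-adjoint operators and the spaces `H_{1/2}`, `H_{-1/2}` -/

/-- A self-adjoint operator `A : D(A) ⊆ H → H` which is strictly positive: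
`⟨A x, x⟩ ≥ m ‖x‖²` on `D(A)` for some `m > 0`. -/
structure StrictlyPositiveSelfAdjoint (H : Type*) [NormedAddCommGroup H]
    [InnerProductSpace ℂ H] [CompleteSpace H] where
  op : H →ₗ.[ℂ] H
  selfAdjoint : IsSelfAdjoint op
  strictlyPositive : ∃ m : ℝ, 0 < m ∧
    ∀ x : op.domain, m * ‖(x : H)‖ ^ 2 ≤ (inner ℂ (op x) (x : H)).re

variable {H : Type*} [NormedAddCommGroup H] [InnerProductSpace ℂ H] [CompleteSpace H]

namespace StrictlyPositiveSelfAdjoint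

variable (A : StrictlyPositiveSelfAdjoint H)

theorem inner_op_left (x y : A.op.domain) :
    inner ℂ (A.op x) (y : H) = inner ℂ (x : H) (A.op y) := by
  have h := LinearPMap.adjoint_isFormalAdjoint A.selfAdjoint.dense_domain
  have h' : A.op.adjoint = A.op := A.selfAdjoint
  rw [h'] at h
  exact h x y

theorem exists_bound : ∃ m : ℝ, 0 < m ∧ ∀ x : A.op.domain, m * ‖(x : H)‖ ≤ ‖A.op x‖ := by
  obtain ⟨m, hm, h⟩ := A.strictlyPositive
  refine ⟨m, hm, fun x => ?_⟩
  rcases eq_or_ne ‖(x : H)‖ 0 with h0 | h0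
  · simp [h0]
  have h1 : m * ‖(x : H)‖ ^ 2 ≤ ‖A.op x‖ * ‖(x : H)‖ :=
    (h x).trans ((Complex.re_le_norm _).trans (norm_inner_le_norm _ _))
  have h2 : 0 < ‖(x : H)‖ := lt_of_le_of_ne (norm_nonneg _) h0.symm
  nlinarith

theorem bijective : Function.Bijective A.op.toFun := by
  obtain ⟨m, hm, hb⟩ := A.exists_bound
  have hinj : Function.Injective A.op.toFun := by
    rw [← LinearMap.ker_eq_bot, LinearMap.ker_eq_bot']
    intro x hx
    have h := hb x
    have hx' : A.op x = 0 := hx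
    rw [hx', norm_zero] at h
    have : ‖(x : H)‖ = 0 := le_antisymm (by nlinarith [norm_nonneg (x : H)]) (norm_nonneg _)
    exact Subtype.ext (norm_eq_zero.1 this)
  refine ⟨hinj, ?_⟩
  have hclosed : IsClosed (LinearMap.range A.op.toFun : Set H) := by
    have hg : IsClosed (A.op.graph : Set (H × H)) := A.selfAdjoint.isClosed
    have : CompleteSpace A.op.graph := hg.completeSpace_coe
    let g : A.op.graph →L[ℂ] H := (ContinuousLinearMap.snd ℂ H H).comp A.op.graph.subtypeL
    have hanti : AntilipschitzWith (Real.toNNReal (max 1 m⁻¹)) g := by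
      apply ContinuousLinearMap.antilipschitz_of_bound
      rintro ⟨⟨x, y⟩, hxy⟩
      obtain ⟨z, hz, hz'⟩ := (LinearPMap.mem_graph_iff _).1 hxy
      simp only at hz hz'
      subst hz hz'
      have hz := hb z
      have h1 : ‖(z : H)‖ ≤ m⁻¹ * ‖A.op z‖ := by
        rw [inv_mul_eq_div, le_div_iff₀ hm]; linarith
      change max ‖(z : H)‖ ‖A.op z‖ ≤ _ * ‖A.op z‖
      rw [Real.coe_toNNReal _ (by positivity)]
      refine max_le (h1.trans ?_) ?_
      · gcongr; exact le_max_right _ _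
      · calc ‖A.op z‖ = 1 * ‖A.op z‖ := (one_mul _).symm
          _ ≤ _ := by gcongr; exact le_max_left _ _
    have := hanti.isClosed_range g.uniformContinuous
    convert this using 1
    ext y
    constructor
    · rintro ⟨x, rfl⟩
      exact ⟨⟨(x, A.op x), LinearPMap.mem_graph _ x⟩, rfl⟩
    · rintro ⟨⟨⟨x, y'⟩, hxy⟩, rfl⟩
      obtain ⟨z, -, hz'⟩ := (LinearPMap.mem_graph_iff _).1 hxy
      exact ⟨z, hz'⟩
  rw [← LinearMap.range_eq_top]
  have : CompleteSpace (LinearMap.range A.op.toFun) := hclosed.completeSpace_coe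
  rw [← Submodule.orthogonal_eq_bot_iff, Submodule.eq_bot_iff]
  intro y hy
  have hz : ∀ x : A.op.domain, inner ℂ y (A.op x) = 0 := fun x => by
    have h := (Submodule.mem_orthogonal _ _).1 hy (A.op x) ⟨x, rfl⟩
    rw [← inner_conj_symm, h, map_zero]
  have hdom : y ∈ A.op.adjoint.domain :=
    LinearPMap.mem_adjoint_domain_of_exists y ⟨0, fun x => by rw [hz, inner_zero_left]⟩
  have h' : A.op.adjoint = A.op := A.selfAdjoint
  have hdom' : y ∈ A.op.domain := h' ▸ hdom
  have hy0 : A.op ⟨y, hdom'⟩ = 0 :=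
    A.selfAdjoint.dense_domain.eq_zero_of_inner_left ℂ fun x hx => by
      rw [A.inner_op_left ⟨y, hdom'⟩ ⟨x, hx⟩]; exact hz _
  have := hinj (hy0.trans (map_zero A.op.toFun).symm)
  simpa using congrArg Subtype.val this

theorem zero_mem_resolventSet : (0 : ℂ) ∈ resolventSet A.op := by
  obtain ⟨m, hm, hb⟩ := A.exists_bound
  let e := LinearEquiv.ofBijective A.op.toFun A.bijective
  have he : ∀ x, A.op (e.symm x) = x := fun x => e.apply_symm_apply x
  let R : H →L[ℂ] H := (-(A.op.domain.subtype.comp e.symm.toLinearMap)).mkContinuous m⁻¹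
    (fun x => by
      have := hb (e.symm x)
      rw [he] at this
      change ‖-((e.symm x : A.op.domain) : H)‖ ≤ _
      rw [norm_neg, inv_mul_eq_div, le_div_iff₀ hm]; linarith)
  refine ⟨R, fun x => ⟨-e.symm x, rfl, ?_⟩, fun y => ?_⟩
  · rw [LinearPMap.map_neg, he]; simp
  · change -((e.symm _ : A.op.domain) : H) = y
    have : (0 : ℂ) • (y : H) - A.op y = e (-y) := by
      rw [map_neg, zero_smul, zero_sub]; rfl
    rw [this, e.symm_apply_apply]; simp

/-- The bounded operator `A⁻¹`. -/
def inv : H →L[ℂ] H := -resolventOp A.op 0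

theorem inv_spec (x : H) : ∃ y : A.op.domain, (y : H) = A.inv x ∧ A.op y = x := by
  obtain ⟨y, hy, hyx⟩ := (isResolventAt_resolventOp A.zero_mem_resolventSet).1 x
  refine ⟨-y, ?_, ?_⟩
  · rw [inv, neg_apply, ← hy]; rfl
  · rw [LinearPMap.map_neg, ← hyx]; simp

theorem inv_op (y : A.op.domain) : A.inv (A.op y) = y := by
  have := (isResolventAt_resolventOp A.zero_mem_resolventSet).2 y
  rw [zero_smul, zero_sub, map_neg] at this
  exact this

theorem inv_nonneg : 0 ≤ A.inv := by
  obtain ⟨m, hm, h⟩ := A.strictlyPositive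
  rw [ContinuousLinearMap.nonneg_iff_isPositive, ContinuousLinearMap.isPositive_iff]
  refine ⟨fun x y => ?_, fun x => ?_⟩
  · obtain ⟨x', hx, rfl⟩ := A.inv_spec x
    obtain ⟨y', hy, rfl⟩ := A.inv_spec y
    change inner ℂ (A.inv _) _ = inner ℂ _ (A.inv _)
    rw [← hx, ← hy, A.inner_op_left]
  · obtain ⟨x', hx, rfl⟩ := A.inv_spec x
    have hre : (starRingEnd ℂ) (inner ℂ (x' : H) (A.op x')) = inner ℂ (x' : H) (A.op x') := by
      rw [inner_conj_symm, A.inner_op_left]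
    have hnn := h x'
    rw [A.inner_op_left] at hnn
    rw [← hx, ← Complex.conj_eq_iff_re.1 hre]
    exact Complex.zero_le_real.2 ((by positivity : 0 ≤ m * ‖(x' : H)‖ ^ 2).trans hnn)

/-- The bounded operator `A^{-1/2}`, the nonnegative square root of `A⁻¹`. -/
def invSqrt : H →L[ℂ] H := CFC.sqrt A.inv

theorem invSqrt_invSqrt (x : H) : A.invSqrt (A.invSqrt x) = A.inv x :=
  congrArg (fun T : H →L[ℂ] H => T x) (CFC.sqrt_mul_sqrt_self A.inv A.inv_nonneg)

theorem invSqrt_injective : Function.Injective A.invSqrt := by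
  intro x y hxy
  have h : A.inv x = A.inv y := by rw [← invSqrt_invSqrt, ← invSqrt_invSqrt, hxy]
  obtain ⟨x', hx, rfl⟩ := A.inv_spec x
  obtain ⟨y', hy, rfl⟩ := A.inv_spec y
  rw [← hx, ← hy] at h
  rw [Subtype.ext h]

theorem inner_invSqrt_left (x y : H) :
    inner ℂ (A.invSqrt x) y = inner ℂ x (A.invSqrt y) :=
  ((ContinuousLinearMap.nonneg_iff_isPositive _).1
    (CFC.sqrt_nonneg A.inv)).inner_left_eq_inner_right x y

/-- `A^{-1/2}` as a linear bijection of `H` onto its range. -/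
def rangeEquiv : H ≃ₗ[ℂ] LinearMap.range A.invSqrt.toLinearMap :=
  LinearEquiv.ofInjective A.invSqrt.toLinearMap A.invSqrt_injective

/-- The space `H_{1/2} = D(A^{1/2})`, i.e. the range of `A^{-1/2}`. -/
def Half : Type _ := LinearMap.range A.invSqrt.toLinearMap

/-- The norm `‖z‖_{1/2} = ‖A^{1/2} z‖` on `H_{1/2}`. -/
instance : NormedAddCommGroup A.Half :=
  NormedAddCommGroup.induced (LinearMap.range A.invSqrt.toLinearMap) H A.rangeEquiv.symm
    A.rangeEquiv.symm.injective

/-- The inner product `⟨A^{1/2} u, A^{1/2} v⟩` on `H_{1/2}`. -/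
instance : InnerProductSpace ℂ A.Half := InnerProductSpace.induced A.rangeEquiv.symm

/-- `A^{-1/2}` as a linear bijection of `H` onto `H_{1/2}`. -/
def invSqrtEquiv : H ≃ₗ[ℂ] A.Half := A.rangeEquiv

/-- The operator `A^{1/2} : H_{1/2} → H`, the inverse of `A^{-1/2}`. -/
def sqrt : A.Half ≃ₗ[ℂ] H := A.invSqrtEquiv.symm

theorem norm_half (u : A.Half) : ‖u‖ = ‖A.sqrt u‖ := rfl

theorem inner_half (u v : A.Half) : inner ℂ u v = inner ℂ (A.sqrt u) (A.sqrt v) := rfl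

instance : CompleteSpace A.Half :=
  (LinearIsometryEquiv.mk A.sqrt fun _ => rfl).toIsometryEquiv.completeSpace

/-- The embedding `H_{1/2} ↪ H`. -/
def incl : A.Half →L[ℂ] H :=
  LinearMap.mkContinuous (Submodule.subtype (LinearMap.range A.invSqrt.toLinearMap) :
    A.Half →ₗ[ℂ] H) ‖A.invSqrt‖ fun u => by
      obtain ⟨x, rfl⟩ := A.invSqrtEquiv.surjective u
      rw [A.norm_half, sqrt, LinearEquiv.symm_apply_apply]
      exact A.invSqrt.le_opNorm x

theorem incl_injective : Function.Injective A.incl := Subtype.val_injective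

theorem invSqrt_sqrt (u : A.Half) : A.invSqrt (A.sqrt u) = A.incl u := by
  obtain ⟨x, rfl⟩ := A.invSqrtEquiv.surjective u
  rw [sqrt, LinearEquiv.symm_apply_apply]
  rfl

/-- `A = A^{1/2} A^{1/2}`, with equality of the domains. -/
theorem mem_graph_op_iff (x y : H) :
    (x, y) ∈ A.op.graph ↔
      ∃ u : A.Half, A.incl u = x ∧ ∃ w : A.Half, A.incl w = A.sqrt u ∧ A.sqrt w = y := by
  constructor
  · intro h
    obtain ⟨z, rfl, rfl⟩ := (LinearPMap.mem_graph_iff _).1 h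
    refine ⟨A.invSqrtEquiv (A.invSqrtEquiv (A.op z) : A.Half).1, ?_, A.invSqrtEquiv (A.op z), ?_, ?_⟩
    · exact (A.invSqrt_invSqrt _).trans (A.inv_op z)
    · rw [sqrt, LinearEquiv.symm_apply_apply]; rfl
    · rw [sqrt, LinearEquiv.symm_apply_apply]
  · rintro ⟨u, rfl, w, hw, rfl⟩
    obtain ⟨z, hz, hz'⟩ := A.inv_spec (A.sqrt w)
    rw [← A.invSqrt_invSqrt, A.invSqrt_sqrt, hw, A.invSqrt_sqrt] at hz
    exact (LinearPMap.mem_graph_iff _).2 ⟨z, hz, hz'⟩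

theorem denseRange_incl : DenseRange A.incl := by
  refine A.selfAdjoint.dense_domain.mono fun x hx => ?_
  obtain ⟨u, hu, -⟩ := (A.mem_graph_op_iff x _).1 (LinearPMap.mem_graph _ ⟨x, hx⟩)
  exact ⟨u, hu⟩

/-- The space `H_{-1/2}`, the dual of `H_{1/2}`, realised as the space of bounded conjugate-linear
functionals on `H_{1/2}`, so that the embedding of the pivot space `H` is linear. -/
abbrev NegHalf : Type _ := A.Half →L⋆[ℂ] ℂ

/-- The embedding `H ↪ H_{-1/2}`: the vector `x` acts on `ψ ∈ H_{1/2}` by the inner product of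
`x` and `ψ` in `H`. (In Mathlib `inner ℂ` is linear in its second argument.) -/
def pivot : H →L[ℂ] A.NegHalf := ((innerSL ℂ).comp A.incl).flip

theorem pivot_apply (x : H) (ψ : A.Half) : A.pivot x ψ = inner ℂ (A.incl ψ) x := rfl

/-- The bounded extension `A : H_{1/2} → H_{-1/2}`: the functional `A u` acts on `ψ ∈ H_{1/2}` by
the inner product of `A^{1/2} u` and `A^{1/2} ψ` in `H`. -/
def ext : A.Half →L[ℂ] A.NegHalf := (innerSL ℂ).flip

theorem ext_apply (u ψ : A.Half) : A.ext u ψ = inner ℂ (A.sqrt ψ) (A.sqrt u) := rfl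

theorem pivot_injective : Function.Injective A.pivot := by
  intro x y hxy
  refine A.denseRange_incl.eq_of_inner_right ℂ ?_
  intro ψ
  exact congrArg (fun f : A.NegHalf => f ψ) hxy

/-- On `D(A)` the extension agrees with `A`. -/
theorem ext_eq_pivot_iff (u : A.Half) (y : H) :
    A.ext u = A.pivot y ↔ (A.incl u, y) ∈ A.op.graph := by
  rw [A.mem_graph_op_iff]
  constructor
  · intro h
    refine ⟨u, rfl, A.invSqrtEquiv y, ?_, by rw [sqrt, LinearEquiv.symm_apply_apply]⟩
    refine ext_inner_left ℂ fun z => ?_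
    have := congrArg (fun f : A.NegHalf => f (A.invSqrtEquiv z)) h
    simp only [ext_apply, pivot_apply] at this
    rw [sqrt, LinearEquiv.symm_apply_apply] at this
    refine Eq.trans ?_ this.symm
    exact (A.inner_invSqrt_left z y).symm
  · rintro ⟨u', hu, w, hw, rfl⟩
    obtain rfl := A.incl_injective hu
    ext ψ
    rw [ext_apply, pivot_apply, ← hw, ← A.invSqrt_sqrt w, ← A.invSqrt_sqrt ψ, A.inner_invSqrt_left]

variable {A} {U : Type*} [NormedAddCommGroup U] [InnerProductSpace ℂ U] [CompleteSpace U]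

/-- The adjoint `B* : H_{1/2} → U` of `B : U → H_{-1/2}`, where `U` is identified with its
dual: the inner product of `x` and `B* ψ` in `U` is the duality pairing of `B x` and `ψ`. -/
def adj (B : U →L[ℂ] A.NegHalf) : A.Half →L[ℂ] U :=
  ((InnerProductSpace.toDual ℂ U).symm.toContinuousLinearEquiv :
    StrongDual ℂ U →L⋆[ℂ] U).comp B.flip

theorem inner_adj (B : U →L[ℂ] A.NegHalf) (ψ : A.Half) (x : U) :
    inner ℂ (adj B ψ) x = B x ψ :=
  InnerProductSpace.toDual_symm_apply

end StrictlyPositiveSelfAdjoint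

open StrictlyPositiveSelfAdjoint

variable {A : StrictlyPositiveSelfAdjoint H}
variable {U : Type*} [NormedAddCommGroup U] [InnerProductSpace ℂ U]

/-! ### The augmented operator of the fractional damping -/

/-- `γ = 2 sin(απ) Γ(1/2 + 1) / π^{1/2 + 1}`. -/
def gam (α : ℝ) : ℝ := 2 * Real.sin (α * Real.pi) * Real.Gamma (1 / 2 + 1) / Real.pi ^ (1 / 2 + 1 : ℝ)

/-- `p(ξ) = |ξ|^{(2α-1)/2}`. -/
def p (α ξ : ℝ) : ℝ := |ξ| ^ ((2 * α - 1) / 2)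

theorem gam_pos {α : ℝ} (hα : α ∈ Ioo (0 : ℝ) 1) : 0 < gam α := by
  have h1 : 0 < Real.sin (α * Real.pi) := Real.sin_pos_of_pos_of_lt_pi
    (mul_pos hα.1 Real.pi_pos) (by nlinarith [Real.pi_pos, hα.2])
  have h2 : 0 < Real.Gamma (1 / 2 + 1) := Real.Gamma_pos_of_pos (by norm_num)
  have := Real.pi_pos
  unfold gam
  positivity

theorem measurable_p (α : ℝ) : Measurable (p α) := by
  unfold p; fun_prop

theorem integrable_p_sq {α : ℝ} (hα : α ∈ Ioo (0 : ℝ) 1) :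
    Integrable (fun ξ : ℝ => (p α ξ / (1 + |ξ|)) ^ 2) := by
  have hm : Measurable (fun ξ : ℝ => (p α ξ / (1 + |ξ|)) ^ 2) :=
    ((measurable_p α).div (by fun_prop)).pow_const 2
  have hpow : ∀ ξ : ℝ, 0 < ξ → p α ξ ^ 2 = ξ ^ (2 * α - 1) := fun ξ hξ => by
    rw [p, abs_of_pos hξ, ← Real.rpow_natCast, ← Real.rpow_mul hξ.le]
    congr 1; push_cast; ring
  have h1 : IntegrableOn (fun ξ : ℝ => (p α ξ / (1 + |ξ|)) ^ 2) (Ioc 0 1) := by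
    have h := (intervalIntegral.intervalIntegrable_rpow' (a := 0) (b := 1)
      (by linarith [hα.1] : -1 < 2 * α - 1))
    rw [intervalIntegrable_iff_integrableOn_Ioc_of_le zero_le_one] at h
    refine h.mono' hm.aestronglyMeasurable ?_
    filter_upwards [ae_restrict_mem measurableSet_Ioc] with ξ hξ
    rw [Real.norm_of_nonneg (sq_nonneg _), div_pow, hpow ξ hξ.1]
    exact div_le_self (Real.rpow_nonneg hξ.1.le _) (by nlinarith [abs_nonneg ξ])
  have h2 : IntegrableOn (fun ξ : ℝ => (p α ξ / (1 + |ξ|)) ^ 2) (Ioi 1) := by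
    have h := integrableOn_Ioi_rpow_of_lt (by linarith [hα.2] : 2 * α - 3 < -1) zero_lt_one
    refine h.mono' hm.aestronglyMeasurable ?_
    filter_upwards [ae_restrict_mem measurableSet_Ioi] with ξ hξ
    have hξ' : (0 : ℝ) < ξ := zero_lt_one.trans hξ
    rw [Real.norm_of_nonneg (sq_nonneg _), div_pow, hpow ξ hξ',
      show 2 * α - 3 = 2 * α - 1 - (2 : ℕ) by push_cast; ring, Real.rpow_sub_natCast hξ'.ne',
      abs_of_pos hξ']
    have := Real.rpow_nonneg hξ'.le (2 * α - 1)
    gcongr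
    linarith
  have h3 : IntegrableOn (fun ξ : ℝ => (p α ξ / (1 + |ξ|)) ^ 2) (Ioi 0) := by
    rw [← Ioc_union_Ioi_eq_Ioi (zero_le_one (α := ℝ))]
    exact h1.union h2
  have h4 : IntegrableOn (fun ξ : ℝ => (p α ξ / (1 + |ξ|)) ^ 2) (Iic 0) := by
    have := (integrableOn_Ici_iff_integrableOn_Ioi (μ := volume)).2 h3
    have h := this.comp_neg
    simpa [p] using h
  have := h4.union h3
  rwa [Iic_union_Ioi, integrableOn_univ] at this

/-- The integral `∫ p(ξ) φ(ξ) dξ` converges if `φ` and `|ξ| φ` belong to `L²(ℝ; U)`. -/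
theorem integrable_p_smul {α : ℝ} (hα : α ∈ Ioo (0 : ℝ) 1) {φ : ℝ → U} (h : MemLp φ 2)
    (h' : MemLp (fun ξ => |ξ| • φ ξ) 2) : Integrable (fun ξ => p α ξ • φ ξ) := by
  have h1 : MemLp (fun ξ : ℝ => p α ξ / (1 + |ξ|)) 2 := by
    refine (memLp_two_iff_integrable_sq ?_).2 (integrable_p_sq hα)
    exact ((measurable_p α).div (by fun_prop)).aestronglyMeasurable
  have h2 := memLp_one_iff_integrable.1 ((h.add h').smul h1 (r := 1))
  refine h2.congr (Eventually.of_forall fun ξ => ?_)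
  have : (1 + |ξ|) ≠ 0 := by positivity
  change (p α ξ / (1 + |ξ|)) • (φ ξ + |ξ| • φ ξ) = _
  rw [show φ ξ + |ξ| • φ ξ = (1 + |ξ|) • φ ξ by rw [add_smul, one_smul], smul_smul,
    div_mul_cancel₀ _ this]

/-- The space `V = L²(ℝ; U)` with the inner product `γ ∫ ⟨φ₁(ξ), φ₂(ξ)⟩ dξ`. -/
abbrev V (U : Type*) [NormedAddCommGroup U] (α : ℝ) : Type _ :=
  Lp U 2 (ENNReal.ofReal (gam α) • (volume : Measure ℝ))

/-- The Hilbert space `H_{1/2} × H × L²(ℝ; U)` with the inner product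
`⟨A^{1/2} u₁, A^{1/2} u₂⟩ + ⟨v₁, v₂⟩ + γ ∫ ⟨φ₁(ξ), φ₂(ξ)⟩ dξ`. -/
abbrev Energy (A : StrictlyPositiveSelfAdjoint H) (U : Type*) [NormedAddCommGroup U] (α : ℝ) :
    Type _ :=
  WithLp 2 (A.Half × WithLp 2 (H × V U α))

theorem ae_V {α : ℝ} (hα : α ∈ Ioo (0 : ℝ) 1) :
    ae (ENNReal.ofReal (gam α) • (volume : Measure ℝ)) = ae volume :=
  Measure.ae_ennreal_smul_measure_eq (by simpa using gam_pos hα) _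

theorem memLp_V {E : Type*} [NormedAddCommGroup E] {α : ℝ} (hα : α ∈ Ioo (0 : ℝ) 1)
    (φ : V E α) : MemLp φ 2 (volume : Measure ℝ) :=
  by
  have h0 : ENNReal.ofReal (gam α) ≠ 0 := by simpa using gam_pos hα
  have h := (Lp.memLp φ).smul_measure (c := (ENNReal.ofReal (gam α))⁻¹) (by simpa using h0)
  rwa [smul_smul, ENNReal.inv_mul_cancel h0 ENNReal.ofReal_ne_top, one_smul] at h

/-- The inner product of the energy space written out. -/
theorem inner_energy {α : ℝ} (hα : α ∈ Ioo (0 : ℝ) 1) (X Y : Energy A U α) :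
    inner ℂ X Y = inner ℂ (A.sqrt X.fst) (A.sqrt Y.fst) + inner ℂ X.snd.fst Y.snd.fst +
      gam α * ∫ ξ : ℝ, inner ℂ (X.snd.snd ξ) (Y.snd.snd ξ) := by
  rw [WithLp.prod_inner_apply, WithLp.prod_inner_apply, L2.inner_def, integral_smul_measure,
    ENNReal.toReal_ofReal (gam_pos hα).le, add_assoc, Complex.real_smul]
  rfl

variable [CompleteSpace U]

/-- The graph of
`𝒜 (u, v, φ) = (v, -A u - γ B ∫ p(ξ) φ(ξ) dξ, -(|ξ|² + η) φ + p(ξ) B* v)` with domain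
`{(u, v, φ) : v ∈ H_{1/2}, A u + γ B ∫ p(ξ) φ(ξ) dξ ∈ H, |ξ| φ ∈ L²(ℝ; U),
-(|ξ|² + η) φ + p(ξ) B* v ∈ L²(ℝ; U)}`. A pair `((u, v, φ), (y, z, ψ))` belongs to it if and only
if `v = y ∈ H_{1/2}`, `A u + γ B ∫ p(ξ) φ(ξ) dξ = -z ∈ H` (an equality in `H_{-1/2}`),
`|ξ| φ ∈ L²(ℝ; U)` and `-(|ξ|² + η) φ + p(ξ) B* v = ψ ∈ L²(ℝ; U)`. -/
def fractionalGraph (B : U →L[ℂ] A.NegHalf) {α : ℝ} (hα : α ∈ Ioo (0 : ℝ) 1) (η : ℝ) :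
    Submodule ℂ (Energy A U α × Energy A U α) where
  carrier := {P | A.incl P.2.fst = P.1.snd.fst ∧
    A.ext P.1.fst + (gam α : ℂ) • B (∫ ξ : ℝ, p α ξ • P.1.snd.snd ξ) = -A.pivot P.2.snd.fst ∧
    MemLp (fun ξ : ℝ => |ξ| • P.1.snd.snd ξ) 2 volume ∧
    ∀ᵐ ξ : ℝ, P.2.snd.snd ξ = -(|ξ| ^ 2 + η) • P.1.snd.snd ξ + p α ξ • adj B P.2.fst}
  zero_mem' := by
    have h0 : ∀ᵐ ξ : ℝ, (0 : V U α) ξ = 0 := by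
      rw [← ae_V hα]; exact Lp.coeFn_zero _ _ _
    have h1 : ∫ ξ : ℝ, p α ξ • (0 : V U α) ξ = 0 := by
      rw [integral_eq_zero_of_ae]
      filter_upwards [h0] with ξ hξ
      rw [hξ, smul_zero, Pi.zero_apply]
    refine ⟨by simp, ?_, ?_, ?_⟩
    · simp only [Prod.fst_zero, Prod.snd_zero, WithLp.zero_fst, WithLp.zero_snd, map_zero, h1,
        neg_zero]
      exact (zero_add _).trans (smul_zero (A := A.NegHalf) (gam α : ℂ))
    · refine (MemLp.zero' : MemLp (fun _ : ℝ => (0 : U)) 2 volume).ae_eq ?_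
      filter_upwards [h0] with ξ hξ
      simp only [Prod.fst_zero, WithLp.zero_snd, hξ, smul_zero]
    · filter_upwards [h0] with ξ hξ
      simp only [Prod.fst_zero, Prod.snd_zero, WithLp.zero_fst, WithLp.zero_snd, map_zero, hξ,
        smul_zero, add_zero]
  add_mem' := by
    rintro ⟨X, Y⟩ ⟨X', Y'⟩ ⟨h1, h2, h3, h4⟩ ⟨h1', h2', h3', h4'⟩
    simp only at h1 h2 h3 h4 h1' h2' h3' h4'
    have hX : ∀ᵐ ξ : ℝ, (X.snd.snd + X'.snd.snd) ξ = X.snd.snd ξ + X'.snd.snd ξ := by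
      rw [← ae_V hα]; exact Lp.coeFn_add _ _
    have hY : ∀ᵐ ξ : ℝ, (Y.snd.snd + Y'.snd.snd) ξ = Y.snd.snd ξ + Y'.snd.snd ξ := by
      rw [← ae_V hα]; exact Lp.coeFn_add _ _
    have hint : ∫ ξ : ℝ, p α ξ • (X.snd.snd + X'.snd.snd) ξ =
        (∫ ξ : ℝ, p α ξ • X.snd.snd ξ) + ∫ ξ : ℝ, p α ξ • X'.snd.snd ξ := by
      rw [← integral_add (integrable_p_smul hα (memLp_V hα _) h3)
        (integrable_p_smul hα (memLp_V hα _) h3')]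
      refine integral_congr_ae ?_
      filter_upwards [hX] with ξ hξ
      rw [hξ, smul_add]
    refine ⟨by simp [h1, h1'], ?_, ?_, ?_⟩
    · simp only [Prod.mk_add_mk, WithLp.add_fst, WithLp.add_snd, map_add, neg_add, hint, smul_add,
        ← h2, ← h2']
      abel
    · refine (h3.add h3').ae_eq ?_
      filter_upwards [hX] with ξ hξ
      simp only [Prod.mk_add_mk, WithLp.add_snd, Pi.add_apply, hξ, smul_add]
    · filter_upwards [hX, hY, h4, h4'] with ξ e1 e2 e3 e4
      simp only [Prod.mk_add_mk, WithLp.add_fst, WithLp.add_snd, map_add, smul_add]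
      rw [e1, e2, e3, e4, smul_add]
      abel
  smul_mem' := by
    rintro c ⟨X, Y⟩ ⟨h1, h2, h3, h4⟩
    simp only at h1 h2 h3 h4
    have hX : ∀ᵐ ξ : ℝ, (c • X.snd.snd) ξ = c • X.snd.snd ξ := by
      rw [← ae_V hα]; exact Lp.coeFn_smul _ _
    have hY : ∀ᵐ ξ : ℝ, (c • Y.snd.snd) ξ = c • Y.snd.snd ξ := by
      rw [← ae_V hα]; exact Lp.coeFn_smul _ _
    have hint : ∫ ξ : ℝ, p α ξ • (c • X.snd.snd) ξ = c • ∫ ξ : ℝ, p α ξ • X.snd.snd ξ := by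
      rw [← integral_smul]
      refine integral_congr_ae ?_
      filter_upwards [hX] with ξ hξ
      rw [hξ, smul_comm]
    refine ⟨by simp [h1], ?_, ?_, ?_⟩
    · simp only [Prod.smul_mk, WithLp.smul_fst, WithLp.smul_snd, map_smul, hint]
      refine Eq.trans ?_ ((congrArg (c • ·) h2).trans (smul_neg c _))
      refine Eq.trans ?_ (smul_add c _ _).symm
      exact congrArg _ (smul_comm _ c _)
    · refine (h3.const_smul c).ae_eq ?_
      filter_upwards [hX] with ξ hξ
      simp only [Prod.smul_mk, WithLp.smul_snd, Pi.smul_apply, hξ, smul_comm c]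
    · filter_upwards [hX, hY, h4] with ξ e1 e2 e3
      simp only [Prod.smul_mk, WithLp.smul_fst, WithLp.smul_snd, map_smul]
      rw [e1, e2, e3, smul_add, smul_comm c, smul_comm c]

/-- The augmented operator `𝒜` on `H_{1/2} × H × L²(ℝ; U)`. -/
def fractionalOp (B : U →L[ℂ] A.NegHalf) {α : ℝ} (hα : α ∈ Ioo (0 : ℝ) 1) (η : ℝ) :
    Energy A U α →ₗ.[ℂ] Energy A U α :=
  (fractionalGraph B hα η).toLinearPMap

/-- The graph above is the graph of a map. -/
theorem fractionalOp_graph (B : U →L[ℂ] A.NegHalf) {α : ℝ} (hα : α ∈ Ioo (0 : ℝ) 1) (η : ℝ) :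
    (fractionalOp B hα η).graph = fractionalGraph B hα η := by
  refine Submodule.toLinearPMap_graph_eq _ ?_
  rintro ⟨X, Y⟩ ⟨h1, h2, h3, h4⟩ h
  simp only at h h1 h2 h3 h4
  subst h
  have h0 : ∀ᵐ ξ : ℝ, (0 : V U α) ξ = 0 := by
    rw [← ae_V hα]; exact Lp.coeFn_zero _ _ _
  have hint : ∫ ξ : ℝ, p α ξ • (0 : V U α) ξ = 0 := by
    rw [integral_eq_zero_of_ae]
    filter_upwards [h0] with ξ hξ
    rw [hξ, smul_zero, Pi.zero_apply]
  have hy : Y.fst = 0 := A.incl_injective (by rw [h1]; simp)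
  have hz : Y.snd.fst = 0 := A.pivot_injective (by
    simp only [WithLp.zero_fst, WithLp.zero_snd, hint, map_zero] at h2
    rw [map_zero, ← neg_eq_zero, ← h2]
    exact (zero_add _).trans (smul_zero (A := A.NegHalf) (gam α : ℂ)))
  have hψ : Y.snd.snd = 0 := by
    rw [Lp.eq_zero_iff_ae_eq_zero, EventuallyEq, ae_V hα]
    filter_upwards [h4, h0] with ξ e1 e2
    simp only [WithLp.zero_snd, e2, hy, map_zero, smul_zero, add_zero] at e1
    exact e1
  exact (WithLp.ofLp_injective 2) (Prod.ext hy ((WithLp.ofLp_injective 2) (Prod.ext hz hψ)))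

/-! ### The operator with the classical damping `BB*` -/

/-- The Hilbert space `H_{1/2} × H`. -/
abbrev Energy0 (A : StrictlyPositiveSelfAdjoint H) : Type _ := WithLp 2 (A.Half × H)

/-- The graph of `𝒜₀ (w, v) = (v, -A w - BB* v)` with domain
`{(w, v) : v ∈ H_{1/2}, A w + BB* v ∈ H}`. A pair `((w, v), (y, z))` belongs to it if and only if
`v = y ∈ H_{1/2}` and `A w + BB* v = -z ∈ H`, an equality in `H_{-1/2}`. -/
def classicalGraph (B : U →L[ℂ] A.NegHalf) : Submodule ℂ (Energy0 A × Energy0 A) where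
  carrier := {P | A.incl P.2.fst = P.1.snd ∧
    A.ext P.1.fst + B (adj B P.2.fst) = -A.pivot P.2.snd}
  zero_mem' := by simp
  add_mem' := by
    rintro P Q ⟨h1, h2⟩ ⟨h3, h4⟩
    refine ⟨by simp [h1, h3], ?_⟩
    simp only [Prod.fst_add, Prod.snd_add, WithLp.add_fst, WithLp.add_snd, map_add, neg_add, ← h2,
      ← h4]
    abel
  smul_mem' := by
    rintro c P ⟨h1, h2⟩
    refine ⟨by simp [h1], ?_⟩
    simp only [Prod.smul_fst, Prod.smul_snd, WithLp.smul_fst, WithLp.smul_snd, map_smul]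
    exact (smul_add c _ _).symm.trans ((congrArg (c • ·) h2).trans (smul_neg c _))

/-- The operator `𝒜₀` on `H_{1/2} × H`. -/
def classicalOp (B : U →L[ℂ] A.NegHalf) : Energy0 A →ₗ.[ℂ] Energy0 A :=
  (classicalGraph B).toLinearPMap

/-- The graph above is the graph of a map. -/
theorem classicalOp_graph (B : U →L[ℂ] A.NegHalf) :
    (classicalOp B).graph = classicalGraph B := by
  refine Submodule.toLinearPMap_graph_eq _ ?_
  rintro ⟨X, Y⟩ ⟨h1, h2⟩ h
  simp only at h h1 h2
  subst h
  have hy : Y.fst = 0 := A.incl_injective (by rw [h1]; simp)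
  have hz : Y.snd = 0 := A.pivot_injective (by
    rw [hy] at h2
    simpa using h2.symm)
  exact (WithLp.ofLp_injective 2) (Prod.ext hy hz)

end FracDamp
end

namespace FracDamp

open StrictlyPositiveSelfAdjoint

/-! ### Bounds for resolvents along the imaginary axis -/

section Resolvent

variable {X : Type*} [NormedAddCommGroup X] [NormedSpace ℂ X] {T : X →ₗ.[ℂ] X}

/-! Let X = (u, v, φ) solve (iω - 𝒜)X = F, and put b = B*v and J = ∫ pφ. In the second component X
satisfies the equation of 𝒜₀ with γJ in place of b, so it suffices to estimate the defect b - γJ and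
to transfer it through the resolvent of 𝒜₀.

Transfer (`norm_sq_add_norm_sq_le`): flipping the sign of the second component turns 𝒜₀ formally
into its adjoint. Solve (-iω - 𝒜₀)W = G with G = (u, -v) and test each equation against the solution
of the other. This gives ‖G‖² as a pairing of F with W minus ⟨b - γJ, c⟩, where c is B* applied to
the second component of W. The dissipation of 𝒜₀ gives ‖c‖² ≤ N‖G‖² when N bounds the resolvent
(`norm_adj_sq_le`). Hence the squared defect is multiplied by N only, not by N².

Defect (`exists_norm_adj_sub_sq_le`): the dissipation of 𝒜 bounds E = ∫ (ξ² + η)‖φ‖² by a multiple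
of ‖F‖‖X‖. Cauchy–Schwarz bounds ‖J‖² by E. To bound b, solve the third equation for pb and
integrate over ξ in [√ω, 2√ω], where ξ² and ω are comparable. This costs the factor ω^(1-α) and is
the only source of that loss (`rpow_mul_norm_sq_le`).

Since η > 0, E also controls φ in L². Altogether ‖X‖² is bounded by quantities of the form (T‖F‖)²
and T‖F‖‖X‖ with T = ω^(1-α)N, and `le_mul_of_sq_le` concludes. -/

theorem IsResolventAt.mem_graph {z : ℂ} {R : X →L[ℂ] X} (h : IsResolventAt T z R) (x : X) :
    (R x, z • R x - x) ∈ T.graph := by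
  obtain ⟨y, hy, hyx⟩ := h.1 x
  refine (LinearPMap.mem_graph_iff _).2 ⟨y, hy, ?_⟩
  change T y = z • R x - x
  rw [← hy, ← hyx, sub_sub_cancel]

/-- The first resolvent identity. -/
theorem IsResolventAt.sub_eq {z z' : ℂ} {R R' : X →L[ℂ] X} (h : IsResolventAt T z R)
    (h' : IsResolventAt T z' R') (x : X) : R' x = R x + (z - z') • R (R' x) := by
  obtain ⟨y, hy, hyx⟩ := h'.1 x
  have h2 := h.2 y
  have : z • (y : X) - T y = x + (z - z') • (y : X) := by
    rw [← hyx, sub_smul]; abel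
  rw [this, map_add, map_smul, hy] at h2
  exact h2.symm

/-- Both resolvents are given, so no Neumann series is needed: the second term of the resolvent
identity is at most half of ‖R' x‖ and is absorbed on the left. -/
theorem IsResolventAt.norm_le_two_mul {z z' : ℂ} {R R' : X →L[ℂ] X} (h : IsResolventAt T z R)
    (h' : IsResolventAt T z' R') (hz : ‖z - z'‖ * ‖R‖ ≤ 1 / 2) : ‖R'‖ ≤ 2 * ‖R‖ := by
  refine ContinuousLinearMap.opNorm_le_bound _ (by positivity) fun x => ?_
  have h1 : ‖R' x‖ ≤ ‖R‖ * ‖x‖ + ‖z - z'‖ * (‖R‖ * ‖R' x‖) := by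
    nth_rewrite 1 [h.sub_eq h' x]
    refine (norm_add_le _ _).trans (add_le_add (R.le_opNorm x) ?_)
    rw [norm_smul]
    exact mul_le_mul_of_nonneg_left (R.le_opNorm _) (norm_nonneg _)
  nlinarith [norm_nonneg (R' x)]

/-- The resolvent is bounded on compact parts of the resolvent set. -/
theorem exists_resolventOp_bound {K : Set ℂ} (hK : IsCompact K) (hKT : K ⊆ resolventSet T) :
    ∃ C : ℝ, ∀ z ∈ K, ‖resolventOp T z‖ ≤ C := by
  refine hK.induction_on (p := fun s => ∃ C : ℝ, ∀ z ∈ s, ‖resolventOp T z‖ ≤ C)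
    ⟨0, by simp⟩ (fun s t hst ⟨C, hC⟩ => ⟨C, fun z hz => hC z (hst hz)⟩)
    (fun s t ⟨C, hC⟩ ⟨D, hD⟩ => ⟨max C D, fun z hz => hz.elim
      (fun h => (hC z h).trans (le_max_left _ _)) fun h => (hD z h).trans (le_max_right _ _)⟩) ?_
  intro z hz
  have hR := isResolventAt_resolventOp (hKT hz)
  set R := resolventOp T z
  have hev : ∀ᶠ z' in nhds z, ‖z - z'‖ * ‖R‖ < 1 / 2 := by
    have hc : Continuous fun z' : ℂ => ‖z - z'‖ * ‖R‖ := by fun_prop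
    exact hc.continuousAt.eventually_lt continuousAt_const (by simp)
  refine ⟨{z' ∈ K | ‖z - z'‖ * ‖R‖ < 1 / 2}, ?_, 2 * ‖R‖, ?_⟩
  · filter_upwards [self_mem_nhdsWithin, nhdsWithin_le_nhds hev] with z' h1 h2 using ⟨h1, h2⟩
  · rintro z' ⟨h1, h2⟩
    exact hR.norm_le_two_mul (isResolventAt_resolventOp (hKT h1)) h2.le

/-- A bound of the resolvent at infinity along the imaginary axis extends to `|ω| ≥ 1`. -/
theorem exists_resolventOp_bound_of_limsup_lt_top {M : ℝ → ℝ} (hM : MonotoneOn M (Ici 0))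
    (hMpos : ∀ r : ℝ, 1 ≤ r → 0 < M r)
    (hT : ∀ ω : ℝ, Complex.I * (ω : ℂ) ∈ resolventSet T)
    (hlim : limsup (fun ω : ℝ => ‖(M |ω|)⁻¹ • resolventOp T (Complex.I * (ω : ℂ))‖ₑ)
      (comap (fun ω : ℝ => |ω|) atTop) < ⊤) :
    ∃ K : ℝ, 0 < K ∧ ∀ ω : ℝ, 1 ≤ |ω| →
      ‖resolventOp T (Complex.I * (ω : ℂ))‖ ≤ K * M |ω| := by
  obtain ⟨c, hc, hctop⟩ := exists_between hlim
  have hev := eventually_lt_of_limsup_lt hc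
  rw [eventually_comap, eventually_atTop] at hev
  obtain ⟨r, hr⟩ := hev
  obtain ⟨D, hD⟩ := exists_resolventOp_bound (T := T)
    (K := (fun ω : ℝ => Complex.I * (ω : ℂ)) '' Icc (-r) r)
    (isCompact_Icc.image (by fun_prop)) (by rintro _ ⟨ω, -, rfl⟩; exact hT ω)
  have hM1 := hMpos 1 le_rfl
  -- `c` serves |ω| ≥ r. On the compact rest, D is converted into a multiple of M |ω| using M 1 ≤ M
  -- |ω|. The 1 only ensures positivity.
  refine ⟨c.toReal + |D| / M 1 + 1, by positivity, fun ω hω => ?_⟩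
  have hMω := hMpos _ hω
  have hmono : M 1 ≤ M |ω| := hM (mem_Ici.2 zero_le_one) (mem_Ici.2 (abs_nonneg ω)) hω
  rcases le_total r |ω| with h | h
  · have h1 := (hr _ h ω rfl).le
    rw [← ofReal_norm, norm_smul, norm_inv, Real.norm_of_nonneg hMω.le] at h1
    have h2 := (ENNReal.ofReal_le_iff_le_toReal hctop.ne).1 h1
    rw [inv_mul_le_iff₀ hMω] at h2
    refine h2.trans ?_
    rw [mul_comm]
    gcongr
    have : 0 ≤ |D| / M 1 := by positivity
    linarith
  · refine (hD _ ⟨ω, abs_le.1 h, rfl⟩).trans ((le_abs_self D).trans ?_)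
    calc |D| = |D| / M 1 * M 1 := (div_mul_cancel₀ _ hM1.ne').symm
      _ ≤ |D| / M 1 * M |ω| := by gcongr
      _ ≤ _ := by
        gcongr
        have := ENNReal.toReal_nonneg (a := c)
        linarith

end Resolvent

/-! ### Scalar and integral estimates for the weight p -/

/-- On `[√ω, 2√ω]` the weight `p²` is at least `ω^α / (2√ω)`. -/
theorem rpow_le_two_mul_sqrt_mul_p_sq {α ω ξ : ℝ} (hα : α ∈ Ioo (0 : ℝ) 1) (hω : 1 ≤ ω)
    (h1 : √ω ≤ ξ) (h2 : ξ ≤ 2 * √ω) : ω ^ α ≤ 2 * √ω * p α ξ ^ 2 := by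
  have hs : 0 < √ω := Real.sqrt_pos.2 (by linarith)
  have hξ : 0 < ξ := hs.trans_le h1
  -- The exponent 2α - 1 of p² may have either sign. One more factor ξ makes it 2α > 0, so the left
  -- endpoint √ω gives the lower bound for every α.
  have h3 : p α ξ ^ 2 * ξ = ξ ^ (2 * α) := by
    rw [p, abs_of_pos hξ, ← Real.rpow_natCast, ← Real.rpow_mul hξ.le]
    nth_rewrite 2 [← Real.rpow_one ξ]
    rw [← Real.rpow_add hξ]
    congr 1; push_cast; ring
  have h4 : ω ^ α = √ω ^ (2 * α) := by
    rw [Real.rpow_mul hs.le, Real.rpow_two, Real.sq_sqrt (by linarith)]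
  rw [h4]
  calc √ω ^ (2 * α) ≤ ξ ^ (2 * α) := Real.rpow_le_rpow hs.le h1 (by linarith [hα.1])
    _ = p α ξ ^ 2 * ξ := h3.symm
    _ ≤ p α ξ ^ 2 * (2 * √ω) := by gcongr
    _ = _ := by ring

variable {U : Type*} [NormedAddCommGroup U] [InnerProductSpace ℂ U]

theorem integrable_weight_mul_norm_sq {φ : ℝ → U} {η : ℝ} (h : MemLp φ 2)
    (h' : MemLp (fun ξ => |ξ| • φ ξ) 2) :
    Integrable (fun ξ : ℝ => (|ξ| ^ 2 + η) * ‖φ ξ‖ ^ 2) := by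
  have h1 := h.integrable_norm_pow two_ne_zero
  have h2 := h'.integrable_norm_pow two_ne_zero
  refine (h2.add (h1.const_mul η)).congr (Eventually.of_forall fun ξ => ?_)
  simp only [Pi.add_apply, norm_smul, Real.norm_eq_abs, abs_abs, mul_pow]
  simp
  ring

/-- `‖∫ p φ‖²` is controlled by the dissipated energy. -/
theorem norm_integral_p_smul_sq_le {α η : ℝ} (hα : α ∈ Ioo (0 : ℝ) 1) (hη : 0 < η) {φ : ℝ → U}
    (h : MemLp φ 2) (h' : MemLp (fun ξ => |ξ| • φ ξ) 2) :
    ‖∫ ξ : ℝ, p α ξ • φ ξ‖ ^ 2 ≤ (∫ ξ : ℝ, (p α ξ / (1 + |ξ|)) ^ 2) *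
      (2 * (1 + 1 / η) * ∫ ξ : ℝ, (|ξ| ^ 2 + η) * ‖φ ξ‖ ^ 2) := by
  have hp : MemLp (fun ξ : ℝ => p α ξ / (1 + |ξ|)) 2 := by
    refine (memLp_two_iff_integrable_sq ?_).2 (integrable_p_sq hα)
    exact ((measurable_p α).div (by fun_prop)).aestronglyMeasurable
  have hψ : MemLp (fun ξ : ℝ => ‖φ ξ + |ξ| • φ ξ‖) 2 := (h.add h').norm
  have hnorm : ∀ ξ : ℝ, ‖φ ξ + |ξ| • φ ξ‖ = (1 + |ξ|) * ‖φ ξ‖ := fun ξ => by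
    have : φ ξ + |ξ| • φ ξ = (1 + |ξ|) • φ ξ := by rw [add_smul, one_smul]
    rw [this, norm_smul, Real.norm_of_nonneg (by positivity)]
  have hp0 : ∀ ξ : ℝ, 0 ≤ p α ξ := fun ξ => by unfold p; positivity
  -- Cauchy–Schwarz for the splitting p‖φ‖ = (p / (1 + |ξ|)) · ((1 + |ξ|)‖φ‖); the first factor is
  -- square integrable because 0 < α < 1.
  have hcs := integral_mul_le_Lp_mul_Lq_of_nonneg (μ := (volume : Measure ℝ))
    Real.HolderConjugate.two_two
    (Eventually.of_forall fun ξ : ℝ =>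
      (div_nonneg (hp0 ξ) (by positivity) : 0 ≤ p α ξ / (1 + |ξ|)))
    (Eventually.of_forall fun ξ => norm_nonneg (φ ξ + |ξ| • φ ξ))
    (by simpa using hp) (by simpa using hψ)
  have hI : ‖∫ ξ : ℝ, p α ξ • φ ξ‖ ≤ ∫ ξ : ℝ, p α ξ / (1 + |ξ|) * ‖φ ξ + |ξ| • φ ξ‖ := by
    refine (norm_integral_le_integral_norm _).trans_eq (integral_congr_ae ?_)
    refine Eventually.of_forall fun ξ => ?_
    have : (1 + |ξ|) ≠ 0 := by positivity
    simp only [hnorm, norm_smul, Real.norm_of_nonneg (hp0 ξ)]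
    field_simp
  simp only [Real.rpow_two, ← Real.sqrt_eq_rpow] at hcs
  have h2 := hI.trans hcs
  have h3 : ∫ ξ : ℝ, ‖φ ξ + |ξ| • φ ξ‖ ^ 2 ≤
      2 * (1 + 1 / η) * ∫ ξ : ℝ, (|ξ| ^ 2 + η) * ‖φ ξ‖ ^ 2 := by
    rw [← integral_const_mul]
    refine integral_mono (hψ.integrable_sq)
      ((integrable_weight_mul_norm_sq h h').const_mul _) fun ξ => ?_
    simp only [hnorm, mul_pow, ← mul_assoc]
    gcongr
    -- The first summand already dominates (1 + |ξ|)²; the other two are nonnegative.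
    have e : 2 * (1 + 1 / η) * (|ξ| ^ 2 + η) =
      2 * (1 + |ξ| ^ 2) + 2 * η + 2 * (|ξ| ^ 2 / η) := by field_simp; ring
    rw [e]
    have : 0 ≤ |ξ| ^ 2 / η := by positivity
    nlinarith [sq_nonneg (1 - |ξ|)]
  calc ‖∫ ξ : ℝ, p α ξ • φ ξ‖ ^ 2 ≤ _ := pow_le_pow_left₀ (norm_nonneg _) h2 2
    _ = (∫ ξ : ℝ, (p α ξ / (1 + |ξ|)) ^ 2) * ∫ ξ : ℝ, ‖φ ξ + |ξ| • φ ξ‖ ^ 2 := by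
      rw [mul_pow, Real.sq_sqrt (integral_nonneg fun ξ => by positivity),
        Real.sq_sqrt (integral_nonneg fun ξ => by positivity)]
    _ ≤ _ := mul_le_mul_of_nonneg_left h3 (integral_nonneg fun ξ => by positivity)

/-- If `(iω + ξ² + η) φ - p b = h`, then `b` is controlled by the dissipated energy of `φ`. -/
theorem rpow_mul_norm_sq_le {α η ω : ℝ} (hα : α ∈ Ioo (0 : ℝ) 1) (hη : 0 < η) (hω : 1 ≤ ω)
    {φ h : ℝ → U} {b : U} (hφ : MemLp φ 2) (hφ' : MemLp (fun ξ => |ξ| • φ ξ) 2) (hh : MemLp h 2)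
    (heq : ∀ᵐ ξ : ℝ, (Complex.I * (ω : ℂ)) • φ ξ - h ξ =
      -(|ξ| ^ 2 + η) • φ ξ + p α ξ • b) :
    ω ^ α * ‖b‖ ^ 2 ≤ 4 * (5 + η) ^ 2 * ω * (∫ ξ : ℝ, (|ξ| ^ 2 + η) * ‖φ ξ‖ ^ 2) +
      4 * ∫ ξ : ℝ, ‖h ξ‖ ^ 2 := by
  have hs : 0 < √ω := Real.sqrt_pos.2 (by linarith)
  have hss : √ω ^ 2 = ω := Real.sq_sqrt (by linarith)
  have hw := integrable_weight_mul_norm_sq (η := η) hφ hφ'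
  have hh2 := hh.integrable_norm_pow two_ne_zero
  have hint : Integrable (fun ξ : ℝ => 2 * √ω *
      (2 * (5 + η) ^ 2 * ω * ((|ξ| ^ 2 + η) * ‖φ ξ‖ ^ 2) + 2 * ‖h ξ‖ ^ 2)) :=
    ((hw.const_mul _).add (hh2.const_mul 2)).const_mul _
  -- The pointwise bound on the window is integrated, and its right side is then enlarged to all of
  -- ℝ.
  have key : ∫ _ξ in Icc (√ω) (2 * √ω), ω ^ α * ‖b‖ ^ 2 ≤ ∫ ξ : ℝ, 2 * √ω *
      (2 * (5 + η) ^ 2 * ω * ((|ξ| ^ 2 + η) * ‖φ ξ‖ ^ 2) + 2 * ‖h ξ‖ ^ 2) := by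
    refine le_trans ?_ (setIntegral_le_integral (s := Icc (√ω) (2 * √ω)) hint
      (Eventually.of_forall fun ξ => by
        change (0 : ℝ) ≤ _
        have : 0 ≤ ω := by linarith
        positivity))
    refine setIntegral_mono_ae_restrict (integrableOn_const (by simp)) hint.integrableOn ?_
    filter_upwards [ae_restrict_mem measurableSet_Icc, ae_restrict_of_ae heq] with ξ hξ he
    have hξ0 : 0 < ξ := hs.trans_le hξ.1
    have h1 := rpow_le_two_mul_sqrt_mul_p_sq hα hω hξ.1 hξ.2
    have hpn : 0 ≤ p α ξ := by unfold p; positivity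
    have h2 : p α ξ * ‖b‖ ≤ (5 + η) * √ω * (ξ * ‖φ ξ‖) + ‖h ξ‖ := by
      have e : p α ξ • b =
          (Complex.I * (ω : ℂ)) • φ ξ + (|ξ| ^ 2 + η) • φ ξ - h ξ := by
        have : p α ξ • b = ((Complex.I * (ω : ℂ)) • φ ξ - h ξ) + (|ξ| ^ 2 + η) • φ ξ := by
          rw [he, neg_smul]; abel
        rw [this]; abel
      have n1 : ‖p α ξ • b‖ ≤ ω * ‖φ ξ‖ + (ξ ^ 2 + η) * ‖φ ξ‖ + ‖h ξ‖ := by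
        rw [e]
        refine (norm_sub_le _ _).trans (add_le_add_left ((norm_add_le _ _).trans ?_) _)
        rw [norm_smul, norm_smul, abs_of_pos hξ0, Real.norm_of_nonneg (by positivity), norm_mul,
          Complex.norm_I, one_mul, Complex.norm_real, Real.norm_of_nonneg (by linarith)]
      rw [norm_smul, Real.norm_of_nonneg hpn] at n1
      refine n1.trans ?_
      -- Here ω, ξ² and η are at most 1, 4 and η times √ω ξ. The factor ξ is kept next to ‖φ‖ so
      -- that its square falls under the dissipated weight.
      have n2 : ω + (ξ ^ 2 + η) ≤ (5 + η) * √ω * ξ := by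
        have a1 : ξ ^ 2 ≤ 4 * ω := by nlinarith [hξ.1, hξ.2]
        have a2 : ω ≤ √ω * ξ := by nlinarith [hξ.1]
        nlinarith
      have := mul_le_mul_of_nonneg_right n2 (norm_nonneg (φ ξ))
      linarith
    have h3 : p α ξ ^ 2 * ‖b‖ ^ 2 ≤
        2 * (5 + η) ^ 2 * ω * ((|ξ| ^ 2 + η) * ‖φ ξ‖ ^ 2) + 2 * ‖h ξ‖ ^ 2 := by
      rw [← mul_pow]
      refine (pow_le_pow_left₀ (by positivity) h2 2).trans ((add_sq_le).trans ?_)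
      rw [mul_add, mul_pow, mul_pow, mul_pow, hss, abs_of_pos hξ0, ← mul_assoc 2, ← mul_assoc 2]
      refine add_le_add_left ?_ _
      refine mul_le_mul_of_nonneg_left ?_ (by have : 0 ≤ ω := by linarith
                                              positivity)
      exact mul_le_mul_of_nonneg_right (by linarith) (sq_nonneg _)
    calc ω ^ α * ‖b‖ ^ 2 ≤ 2 * √ω * p α ξ ^ 2 * ‖b‖ ^ 2 := by gcongr
      _ = 2 * √ω * (p α ξ ^ 2 * ‖b‖ ^ 2) := by ring
      _ ≤ _ := by gcongr
  rw [setIntegral_const, integral_const_mul,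
    integral_add (hw.const_mul _) (hh2.const_mul 2), integral_const_mul, integral_const_mul] at key
  -- The length √ω of the window cancels the √ω from the lower bound on p², leaving ω^α on the left.
  have hvol : volume.real (Icc (√ω) (2 * √ω)) = √ω := by
    rw [Real.volume_real_Icc_of_le (by linarith)]; ring
  rw [hvol, smul_eq_mul, mul_comm 2 (√ω), mul_assoc (√ω)] at key
  have := le_of_mul_le_mul_left key hs
  linarith

/-! ### Weak forms and dissipation identities -/

variable {H : Type*} [NormedAddCommGroup H] [InnerProductSpace ℂ H] [CompleteSpace H]
variable {A : StrictlyPositiveSelfAdjoint H}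

/-- The norm of the energy space written out. -/
theorem norm_energy_sq {α : ℝ} (hα : α ∈ Ioo (0 : ℝ) 1) (X : Energy A U α) :
    ‖X‖ ^ 2 = ‖X.fst‖ ^ 2 + ‖X.snd.fst‖ ^ 2 + gam α * ∫ ξ : ℝ, ‖X.snd.snd ξ‖ ^ 2 := by
  have h := inner_energy hα X X
  simp only [inner_self_eq_norm_sq_to_K] at h
  have h2 : ∫ ξ : ℝ, ((‖X.snd.snd ξ‖ : ℂ)) ^ 2 = ((∫ ξ : ℝ, ‖X.snd.snd ξ‖ ^ 2 : ℝ) : ℂ) := by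
    rw [← integral_complex_ofReal]; push_cast; rfl
  change (‖X‖ : ℂ) ^ 2 = (‖X.fst‖ : ℂ) ^ 2 + (‖X.snd.fst‖ : ℂ) ^ 2 +
    gam α * ∫ ξ : ℝ, (‖X.snd.snd ξ‖ : ℂ) ^ 2 at h
  rw [h2] at h
  exact_mod_cast h

theorem inner_self_eq_ofReal {E : Type*} [NormedAddCommGroup E] [InnerProductSpace ℂ E] (x : E) :
    inner ℂ x x = ((‖x‖ ^ 2 : ℝ) : ℂ) := by
  rw [inner_self_eq_norm_sq_to_K, Complex.ofReal_pow]; rfl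

/-- The inner product is conjugate-linear on the left, hence the factor -iω. For w = x that term is
purely imaginary and drops out of the dissipation estimates. -/
theorem inner_smul_sub_left {E : Type*} [NormedAddCommGroup E] [InnerProductSpace ℂ E] (ω : ℝ)
    (x f w : E) : inner ℂ ((Complex.I * (ω : ℂ)) • x - f) w =
      -(Complex.I * ω) * inner ℂ x w - inner ℂ f w := by
  rw [inner_sub_left, inner_smul_left, map_mul, Complex.conj_I, Complex.conj_ofReal, neg_mul]

variable [CompleteSpace U]

/-- The weak form of the second component of the equation for `𝒜`. -/
theorem inner_of_mem_fractionalGraph {B : U →L[ℂ] A.NegHalf} {α η : ℝ} {hα : α ∈ Ioo (0 : ℝ) 1}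
    {X Y : Energy A U α} (h : (X, Y) ∈ fractionalGraph B hα η) (ψ : A.Half) :
    inner ℂ ψ X.fst + gam α * inner ℂ (adj B ψ) (∫ ξ : ℝ, p α ξ • X.snd.snd ξ) =
      -inner ℂ (A.incl ψ) Y.snd.fst := by
  have := congrArg (fun f : A.NegHalf => f ψ) h.2.1
  rw [inner_adj]
  exact this

/-- The weak form of the second component of the equation for `𝒜₀`. -/
theorem inner_of_mem_classicalGraph {B : U →L[ℂ] A.NegHalf} {X Y : Energy0 A}
    (h : (X, Y) ∈ classicalGraph B) (ψ : A.Half) :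
    inner ℂ ψ X.fst + inner ℂ (adj B ψ) (adj B Y.fst) = -inner ℂ (A.incl ψ) Y.snd := by
  have := congrArg (fun f : A.NegHalf => f ψ) h.2
  rw [inner_adj]
  exact this

/-- The dissipation identity for `𝒜`. -/
theorem re_inner_of_mem_fractionalGraph {B : U →L[ℂ] A.NegHalf} {α η : ℝ}
    {hα : α ∈ Ioo (0 : ℝ) 1} {X Y : Energy A U α} (h : (X, Y) ∈ fractionalGraph B hα η) :
    (inner ℂ Y X).re = -(gam α * ∫ ξ : ℝ, (|ξ| ^ 2 + η) * ‖X.snd.snd ξ‖ ^ 2) := by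
  obtain ⟨h1, -, h3, h4⟩ := id h
  have hw := inner_of_mem_fractionalGraph h Y.fst
  simp only at h1 h3 h4
  have hφ := memLp_V hα X.snd.snd
  have hint := integrable_p_smul hα hφ h3
  have hI : ∫ ξ : ℝ, inner ℂ (Y.snd.snd ξ) (X.snd.snd ξ) =
      -((∫ ξ : ℝ, (|ξ| ^ 2 + η) * ‖X.snd.snd ξ‖ ^ 2 : ℝ) : ℂ) +
        inner ℂ (adj B Y.fst) (∫ ξ : ℝ, p α ξ • X.snd.snd ξ) := by
    rw [← integral_complex_ofReal, ← integral_neg, ← integral_inner hint, ← integral_add]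
    · refine integral_congr_ae ?_
      filter_upwards [h4] with ξ e
      rw [e, ← Complex.coe_smul, ← Complex.coe_smul, ← Complex.coe_smul, inner_add_left,
        inner_smul_left, inner_smul_left, inner_smul_right, Complex.conj_ofReal,
        Complex.conj_ofReal, inner_self_eq_norm_sq_to_K]
      push_cast
      rw [neg_mul]
      rfl
    · exact (integrable_weight_mul_norm_sq hφ h3).ofReal.neg
    · exact hint.const_inner _
  rw [inner_energy hα, hI, ← inner_half, ← inner_conj_symm Y.snd.fst]
  rw [h1] at hw
  have hw' : inner ℂ X.snd.fst Y.snd.fst = -(inner ℂ Y.fst X.fst +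
    gam α * inner ℂ (adj B Y.fst) (∫ ξ : ℝ, p α ξ • X.snd.snd ξ)) := by rw [hw, neg_neg]
  rw [hw']
  generalize ∫ ξ : ℝ, p α ξ • X.snd.snd ξ = J
  generalize ∫ ξ : ℝ, (|ξ| ^ 2 + η) * ‖X.snd.snd ξ‖ ^ 2 = E
  rw [map_neg, map_add, map_mul, inner_conj_symm, Complex.conj_ofReal, mul_add, mul_neg,
    ← Complex.ofReal_mul]
  -- The coupling terms of the second and third components are negatives of each other up to
  -- conjugation, as are those of the first two, so only the dissipated energy survives in the real
  -- part.
  have h5 : (gam α * inner ℂ (adj B Y.fst) J : ℂ).re = (gam α * inner ℂ J (adj B Y.fst) : ℂ).re := by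
    rw [Complex.re_ofReal_mul, Complex.re_ofReal_mul, ← inner_conj_symm, Complex.conj_re]
  have h6 : (inner ℂ Y.fst X.fst : ℂ).re = (inner ℂ X.fst Y.fst : ℂ).re := by
    refine (Complex.conj_re _).symm.trans (congrArg Complex.re ?_)
    exact inner_conj_symm X.fst Y.fst
  simp only [Complex.add_re, Complex.neg_re, Complex.ofReal_re, Complex.conj_re]
  linarith

/-- The dissipation identity for `𝒜₀`. -/
theorem re_inner_of_mem_classicalGraph {B : U →L[ℂ] A.NegHalf} {X Y : Energy0 A}
    (h : (X, Y) ∈ classicalGraph B) : (inner ℂ Y X).re = -‖adj B Y.fst‖ ^ 2 := by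
  have hw := inner_of_mem_classicalGraph h Y.fst
  have h1 : A.incl Y.fst = X.snd := h.1
  rw [h1, inner_self_eq_ofReal] at hw
  have hw' : inner ℂ X.snd Y.snd = -(inner ℂ Y.fst X.fst + ((‖adj B Y.fst‖ ^ 2 : ℝ) : ℂ)) := by
    rw [← neg_neg (inner ℂ X.snd Y.snd), ← hw]
  rw [WithLp.prod_inner_apply]
  change (inner ℂ Y.fst X.fst + inner ℂ Y.snd X.snd).re = _
  rw [← inner_conj_symm Y.snd, hw']
  simp only [map_neg, map_add, Complex.add_re, Complex.neg_re, Complex.conj_re, Complex.ofReal_re]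
  ring

/-- The observation `B*` of the classical resolvent is bounded by the square root of the
resolvent. -/
theorem norm_adj_sq_le {B : U →L[ℂ] A.NegHalf} {ω N : ℝ} {G W : Energy0 A}
    (h : (W, (Complex.I * (ω : ℂ)) • W - G) ∈ classicalGraph B) (hW : ‖W‖ ≤ N * ‖G‖) :
    ‖adj B ((Complex.I * (ω : ℂ)) • W - G).fst‖ ^ 2 ≤ N * ‖G‖ ^ 2 := by
  have h1 := re_inner_of_mem_classicalGraph h
  rw [inner_smul_sub_left, inner_self_eq_ofReal] at h1
  have h2 : (inner ℂ G W).re ≤ ‖G‖ * ‖W‖ := 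
    (Complex.re_le_norm _).trans (norm_inner_le_norm G W)
  -- With this term gone, the dissipation identity reads ‖B* Z.fst‖² = Re ⟨G, W⟩ for Z = iωW - G.
  have h3 : (-(Complex.I * (ω : ℂ)) * ((‖W‖ ^ 2 : ℝ) : ℂ)).re = 0 := by
    rw [Complex.re_mul_ofReal]; simp
  rw [Complex.sub_re] at h1
  have h4 := mul_le_mul_of_nonneg_left hW (norm_nonneg G)
  linarith

/-! ### Comparison of 𝒜 with 𝒜₀ -/

/-- The duality estimate comparing solutions of the resolvent equation for `𝒜` with the
resolvent of `𝒜₀`. -/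
theorem norm_sq_add_norm_sq_le {B : U →L[ℂ] A.NegHalf} {α η ω N : ℝ} {hα : α ∈ Ioo (0 : ℝ) 1}
    {X F : Energy A U α} (hN : 0 ≤ N)
    (hX : (X, (Complex.I * (ω : ℂ)) • X - F) ∈ fractionalGraph B hα η)
    {R : Energy0 A →L[ℂ] Energy0 A}
    (hR : IsResolventAt (classicalOp B) (Complex.I * ((-ω : ℝ) : ℂ)) R) (hRN : ‖R‖ ≤ N) :
    ‖X.fst‖ ^ 2 + ‖X.snd.fst‖ ^ 2 ≤ 2 * N ^ 2 * ‖F‖ ^ 2 +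
      2 * N * ‖adj B ((Complex.I * (ω : ℂ)) • X - F).fst -
        (gam α : ℂ) • ∫ ξ : ℝ, p α ξ • X.snd.snd ξ‖ ^ 2 := by
  set G : Energy0 A := WithLp.toLp 2 (X.fst, -X.snd.fst) with hG
  set W := R G
  set I := ∫ ξ : ℝ, p α ξ • X.snd.snd ξ
  have hW := hR.mem_graph G
  rw [classicalOp_graph] at hW
  have hWn : ‖W‖ ≤ N * ‖G‖ := (R.le_opNorm G).trans (by gcongr)
  have hGn : ‖G‖ ^ 2 = ‖X.fst‖ ^ 2 + ‖X.snd.fst‖ ^ 2 := by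
    rw [WithLp.prod_norm_sq_eq_of_L2]; simp [hG]
  have hz := norm_adj_sq_le hW hWn
  set Y := (Complex.I * (ω : ℂ)) • X - F
  set Z := (Complex.I * ((-ω : ℝ) : ℂ)) • W - G
  -- Cross-testing: `Y.fst` is v and `Z.fst` is the second component of W, both as elements of
  -- H_{1/2}, so the unbounded B enters only through its adjoint.
  have e1 := inner_of_mem_classicalGraph hW Y.fst
  have e2 := inner_of_mem_fractionalGraph hX Z.fst
  have i1 : A.incl Y.fst = X.snd.fst := hX.1
  have i2 : A.incl Z.fst = W.snd := hW.1
  rw [i1] at e1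
  rw [i2] at e2
  have e2' := congrArg (starRingEnd ℂ) e2
  simp only [map_add, map_mul, map_neg, inner_conj_symm, Complex.conj_ofReal] at e2'
  set b := adj B Y.fst
  set c := adj B Z.fst
  have key : inner ℂ F.fst W.fst - inner ℂ F.snd.fst W.snd - inner ℂ (b - (gam α : ℂ) • I) c =
      ((‖G‖ ^ 2 : ℝ) : ℂ) := by
    have s1 : inner ℂ Y.fst W.fst = -(Complex.I * ω) * inner ℂ X.fst W.fst - inner ℂ F.fst W.fst :=
      inner_smul_sub_left ω X.fst F.fst W.fst
    have s2 : inner ℂ Y.snd.fst W.snd =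
        -(Complex.I * ω) * inner ℂ X.snd.fst W.snd - inner ℂ F.snd.fst W.snd :=
      inner_smul_sub_left ω X.snd.fst F.snd.fst W.snd
    have s3 : inner ℂ Z.fst X.fst =
        -(Complex.I * ((-ω : ℝ) : ℂ)) * inner ℂ W.fst X.fst - inner ℂ X.fst X.fst :=
      inner_smul_sub_left (-ω) W.fst X.fst X.fst
    have s4 : inner ℂ Z.snd X.snd.fst =
        -(Complex.I * ((-ω : ℝ) : ℂ)) * inner ℂ W.snd X.snd.fst - inner ℂ (-X.snd.fst) X.snd.fst :=
      inner_smul_sub_left (-ω) W.snd (-X.snd.fst) X.snd.fst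
    have s5 : inner ℂ X.fst X.fst = ((‖X.fst‖ ^ 2 : ℝ) : ℂ) := inner_self_eq_ofReal X.fst
    have s6 : (starRingEnd ℂ) (inner ℂ W.fst X.fst) = inner ℂ X.fst W.fst :=
      inner_conj_symm X.fst W.fst
    rw [s5] at s3
    rw [inner_neg_left, inner_self_eq_ofReal] at s4
    replace s3 := congrArg (starRingEnd ℂ) s3
    replace s4 := congrArg (starRingEnd ℂ) s4
    simp only [map_sub, map_neg, map_mul, inner_conj_symm, s6, Complex.conj_ofReal,
      Complex.conj_I, Complex.ofReal_neg] at s3 s4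
    rw [inner_sub_left, inner_smul_left, Complex.conj_ofReal, hGn]
    rw [Complex.ofReal_add]
    change inner ℂ Y.fst W.fst + inner ℂ b c = _ at e1
    rw [s1, s4] at e1
    rw [s2, s3] at e2'
    -- The terms with iω cancel because the two problems sit at opposite frequencies.
    linear_combination e2' - e1
  have n0 : ‖G‖ ^ 2 ≤ ‖inner ℂ F.fst W.fst - inner ℂ F.snd.fst W.snd‖ +
      ‖inner ℂ (b - (gam α : ℂ) • I) c‖ := by
    have : ‖((‖G‖ ^ 2 : ℝ) : ℂ)‖ = ‖G‖ ^ 2 := by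
      rw [Complex.norm_real, Real.norm_of_nonneg (by positivity)]
    rw [← this, ← key]
    exact norm_sub_le _ _
  have n1 : ‖inner ℂ F.fst W.fst - inner ℂ F.snd.fst W.snd‖ ≤ ‖F‖ * ‖W‖ := by
    set F0 : Energy0 A := WithLp.toLp 2 (F.fst, -F.snd.fst)
    have a1 : inner ℂ F0 W = inner ℂ F.fst W.fst - inner ℂ F.snd.fst W.snd := by
      rw [WithLp.prod_inner_apply, sub_eq_add_neg, ← inner_neg_left]
      rfl
    have a2 : ‖F0‖ ≤ ‖F‖ := by
      rw [← pow_le_pow_iff_left₀ (norm_nonneg _) (norm_nonneg _) two_ne_zero,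
        WithLp.prod_norm_sq_eq_of_L2, norm_energy_sq hα]
      change ‖F.fst‖ ^ 2 + ‖-F.snd.fst‖ ^ 2 ≤ _
      rw [norm_neg]
      have h0 := (gam_pos hα).le
      have h1 : 0 ≤ ∫ ξ : ℝ, ‖F.snd.snd ξ‖ ^ 2 := integral_nonneg fun ξ => by positivity
      have := mul_nonneg h0 h1
      linarith
    rw [← a1]
    exact (norm_inner_le_norm _ _).trans (by gcongr)
  have n2 := norm_inner_le_norm (𝕜 := ℂ) (b - (gam α : ℂ) • I) c
  set x := ‖b - (gam α : ℂ) • I‖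
  rw [← hGn]
  have n3 : ‖G‖ ^ 2 ≤ ‖F‖ * (N * ‖G‖) + x * ‖c‖ := by
    have := mul_le_mul_of_nonneg_left hWn (norm_nonneg F)
    linarith
  have n4 : ‖c‖ ≤ √N * ‖G‖ := by
    rw [← pow_le_pow_iff_left₀ (norm_nonneg _) (by positivity) two_ne_zero, mul_pow, Real.sq_sqrt hN]
    exact hz
  have hx : 0 ≤ x := norm_nonneg _
  have n5 : ‖G‖ * ‖G‖ ≤ (N * ‖F‖ + √N * x) * ‖G‖ := by
    have := mul_le_mul_of_nonneg_left n4 hx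
    nlinarith
  have n6 : ‖G‖ ≤ N * ‖F‖ + √N * x := by
    -- The bound on c carries a factor ‖G‖, so the whole inequality can be divided by it.
    rcases (norm_nonneg G).eq_or_lt with h0 | h0
    · rw [← h0]; positivity
    · exact le_of_mul_le_mul_right n5 h0
  refine (pow_le_pow_left₀ (norm_nonneg _) n6 2).trans (add_sq_le.trans_eq ?_)
  rw [mul_pow, mul_pow, Real.sq_sqrt hN]; ring

/-- Solutions of the resolvent equation for `𝒜` dissipate at most `‖F‖ ‖X‖`. -/
theorem gam_mul_integral_le {B : U →L[ℂ] A.NegHalf} {α η ω : ℝ} {hα : α ∈ Ioo (0 : ℝ) 1}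
    {X F : Energy A U α}
    (hX : (X, (Complex.I * (ω : ℂ)) • X - F) ∈ fractionalGraph B hα η) :
    gam α * ∫ ξ : ℝ, (|ξ| ^ 2 + η) * ‖X.snd.snd ξ‖ ^ 2 ≤ ‖F‖ * ‖X‖ := by
  have h1 := re_inner_of_mem_fractionalGraph hX
  rw [inner_smul_sub_left, inner_self_eq_ofReal] at h1
  have h2 : (inner ℂ F X).re ≤ ‖F‖ * ‖X‖ :=
    (Complex.re_le_norm _).trans (norm_inner_le_norm F X)
  have h3 : (-(Complex.I * (ω : ℂ)) * ((‖X‖ ^ 2 : ℝ) : ℂ)).re = 0 := by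
    rw [Complex.re_mul_ofReal]; simp
  rw [Complex.sub_re] at h1
  linarith

/-- The difference of the two dampings is controlled by the dissipation and the data. -/
theorem exists_norm_adj_sub_sq_le (B : U →L[ℂ] A.NegHalf) {α η : ℝ} (hα : α ∈ Ioo (0 : ℝ) 1)
    (hη : 0 < η) : ∃ C : ℝ, 0 < C ∧ ∀ (ω : ℝ) (X F : Energy A U α), 1 ≤ ω →
      (X, (Complex.I * (ω : ℂ)) • X - F) ∈ fractionalGraph B hα η →
      ‖adj B ((Complex.I * (ω : ℂ)) • X - F).fst -
        (gam α : ℂ) • ∫ ξ : ℝ, p α ξ • X.snd.snd ξ‖ ^ 2 ≤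
        C * (ω ^ (1 - α) * (‖F‖ * ‖X‖) + ‖F‖ ^ 2) := by
  have hg := gam_pos hα
  set P := ∫ ξ : ℝ, (p α ξ / (1 + |ξ|)) ^ 2
  have hP : 0 ≤ P := integral_nonneg fun ξ => by positivity
  set a := 4 * (5 + η) ^ 2 / gam α
  set c := P * (2 * (1 + 1 / η)) * gam α
  have ha : 0 < a := by positivity
  have hc : 0 ≤ c := by positivity
  -- `a` and `4 / gam α` come from b (dissipation and data), `c` from γJ; the 2 is from squaring a
  -- sum.
  refine ⟨2 * (a + c + 4 / gam α), by positivity, fun ω X F hω hX => ?_⟩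
  have hω0 : 0 < ω := by linarith
  have hD := gam_mul_integral_le hX
  have h3 := hX.2.2.1
  simp only at h3
  have hφ := memLp_V hα X.snd.snd
  have hF := memLp_V hα F.snd.snd
  have hY : ∀ᵐ ξ : ℝ, ((Complex.I * (ω : ℂ)) • X - F).snd.snd ξ =
      (Complex.I * (ω : ℂ)) • X.snd.snd ξ - F.snd.snd ξ := by
    have e1 := Lp.coeFn_sub ((Complex.I * (ω : ℂ)) • X.snd.snd) F.snd.snd
    have e2 := Lp.coeFn_smul (Complex.I * (ω : ℂ)) X.snd.snd
    rw [EventuallyEq, ae_V hα] at e1 e2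
    filter_upwards [e1, e2] with ξ h1 h2
    refine h1.trans ?_
    rw [Pi.sub_apply, h2, Pi.smul_apply]
  have heq : ∀ᵐ ξ : ℝ, (Complex.I * (ω : ℂ)) • X.snd.snd ξ - F.snd.snd ξ =
      -(|ξ| ^ 2 + η) • X.snd.snd ξ + p α ξ • adj B ((Complex.I * (ω : ℂ)) • X - F).fst := by
    filter_upwards [hY, hX.2.2.2] with ξ h1 h2
    rw [← h1]; exact h2
  have hb := rpow_mul_norm_sq_le hα hη hω hφ h3 hF heq
  have hI := norm_integral_p_smul_sq_le hα hη hφ h3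
  have hFn : gam α * ∫ ξ : ℝ, ‖F.snd.snd ξ‖ ^ 2 ≤ ‖F‖ ^ 2 := by
    rw [norm_energy_sq hα F]
    linarith [sq_nonneg ‖F.fst‖, sq_nonneg ‖F.snd.fst‖]
  set b := adj B ((Complex.I * (ω : ℂ)) • X - F).fst
  set J := ∫ ξ : ℝ, p α ξ • X.snd.snd ξ
  set E := ∫ ξ : ℝ, (|ξ| ^ 2 + η) * ‖X.snd.snd ξ‖ ^ 2
  set h2 := ∫ ξ : ℝ, ‖F.snd.snd ξ‖ ^ 2
  set D := ‖F‖ * ‖X‖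
  have hD0 : 0 ≤ D := by positivity
  have hωα : 1 ≤ ω ^ α := Real.one_le_rpow hω hα.1.le
  have hω1 : 1 ≤ ω ^ (1 - α) := Real.one_le_rpow hω (by linarith [hα.2])
  have hmul : ω ^ α * ω ^ (1 - α) = ω := by
    rw [← Real.rpow_add hω0]; simp
  have hE : E ≤ D / gam α := by rw [le_div_iff₀ hg]; linarith
  have hh : h2 ≤ ‖F‖ ^ 2 / gam α := by rw [le_div_iff₀ hg]; linarith
  have b1 : ‖b‖ ^ 2 ≤ a * (ω ^ (1 - α) * D) + 4 / gam α * ‖F‖ ^ 2 := by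
    -- Dividing ω = ω^α ω^(1-α) by ω^α leaves the loss ω^(1-α) on the dissipation; the data term
    -- loses nothing since ω^α ≥ 1.
    have : ω ^ α * ‖b‖ ^ 2 ≤ ω ^ α * (a * (ω ^ (1 - α) * D) + 4 / gam α * ‖F‖ ^ 2) := by
      calc ω ^ α * ‖b‖ ^ 2 ≤ 4 * (5 + η) ^ 2 * ω * E + 4 * h2 := hb
        _ ≤ 4 * (5 + η) ^ 2 * ω * (D / gam α) + 4 * (‖F‖ ^ 2 / gam α) := by gcongr
        _ = a * (ω ^ α * ω ^ (1 - α) * D) + 1 * (4 / gam α * ‖F‖ ^ 2) := by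
          rw [hmul]; simp only [a]; ring
        _ ≤ a * (ω ^ α * ω ^ (1 - α) * D) + ω ^ α * (4 / gam α * ‖F‖ ^ 2) := by gcongr
        _ = _ := by ring
    exact le_of_mul_le_mul_left this (by positivity)
  have j1 : ‖(gam α : ℂ) • J‖ ^ 2 ≤ c * (ω ^ (1 - α) * D) := by
    rw [norm_smul, Complex.norm_real, Real.norm_of_nonneg hg.le, mul_pow]
    calc gam α ^ 2 * ‖J‖ ^ 2 ≤ gam α ^ 2 * (P * (2 * (1 + 1 / η) * E)) := by gcongr
      _ ≤ gam α ^ 2 * (P * (2 * (1 + 1 / η) * (D / gam α))) := by gcongr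
      _ = c * (1 * D) := by simp only [c]; field_simp
      _ ≤ _ := by gcongr
  calc ‖b - (gam α : ℂ) • J‖ ^ 2 ≤ (‖b‖ + ‖(gam α : ℂ) • J‖) ^ 2 := by
        gcongr; exact norm_sub_le _ _
    _ ≤ 2 * (‖b‖ ^ 2 + ‖(gam α : ℂ) • J‖ ^ 2) := add_sq_le
    _ ≤ 2 * ((a * (ω ^ (1 - α) * D) + 4 / gam α * ‖F‖ ^ 2) + c * (ω ^ (1 - α) * D)) := by gcongr
    _ ≤ _ := by
      have t1 : 0 ≤ 4 / gam α * (ω ^ (1 - α) * D) := by positivity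
      have t2 : 0 ≤ (a + c) * ‖F‖ ^ 2 := by positivity
      linarith

/-- A quadratic inequality for `x` gives a linear bound. -/
theorem le_mul_of_sq_le {x y r q : ℝ} (hy : 0 ≤ y) (hr : 0 ≤ r) (hq : 0 ≤ q)
    (h : x ^ 2 ≤ r * y ^ 2 + q * (y * x)) : x ≤ (r + q + 1) * y := by
  by_contra! hlt
  -- Once y ≤ x, the term r y² is at most r y x, and x can be cancelled.
  have h1 : y ≤ x := by nlinarith [mul_nonneg (add_nonneg hr hq) hy]
  have h2 : x * x ≤ (r + q) * y * x := by
    nlinarith [mul_le_mul_of_nonneg_left h1 (mul_nonneg hr hy)]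
  have h3 : 0 < x := lt_of_le_of_lt (by positivity) hlt
  have h4 := le_of_mul_le_mul_right h2 h3
  linarith

end FracDamp

/-! ### Conclusion -/

theorem mainTheorem1 {H U : Type*}
    [NormedAddCommGroup H] [InnerProductSpace ℂ H] [CompleteSpace H]
    [NormedAddCommGroup U] [InnerProductSpace ℂ U] [CompleteSpace U]
    (A : FracDamp.StrictlyPositiveSelfAdjoint H) (B : U →L[ℂ] A.NegHalf)
    {α : ℝ} (hα : α ∈ Ioo (0 : ℝ) 1) {η : ℝ} (hη : 0 < η)
    (M : ℝ → ℝ) (hM : MonotoneOn M (Ici 0)) (hMpos : ∀ r : ℝ, 1 ≤ r → 0 < M r)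
    (hρ : ∀ ω : ℝ, Complex.I * (ω : ℂ) ∈ FracDamp.resolventSet (FracDamp.fractionalOp B hα η))
    (hρ₀ : ∀ ω : ℝ, Complex.I * (ω : ℂ) ∈ FracDamp.resolventSet (FracDamp.classicalOp B))
    (hlim : limsup (fun ω : ℝ =>
        ‖(M |ω|)⁻¹ • FracDamp.resolventOp (FracDamp.classicalOp B) (Complex.I * (ω : ℂ))‖ₑ)
      (comap (fun ω : ℝ => |ω|) atTop) < ⊤) :
    ∃ C : ℝ, 0 < C ∧ ∀ ω : ℝ, 1 ≤ ω →
      ‖FracDamp.resolventOp (FracDamp.fractionalOp B hα η) (Complex.I * (ω : ℂ))‖ ≤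
        C * |ω| ^ (1 - α) * M |ω| := by
  obtain ⟨K, hK, hKM⟩ :=
    FracDamp.exists_resolventOp_bound_of_limsup_lt_top hM hMpos hρ₀ hlim
  obtain ⟨C, hC, hCb⟩ := FracDamp.exists_norm_adj_sub_sq_le B hα hη
  have hM1 := hMpos 1 le_rfl
  -- A lower bound, uniform in ω ≥ 1, for N = K M(ω) and hence for T. It lets lower powers of T be
  -- raised: N ≤ T²/n and 1 ≤ T/n, which explains the constants `r` and `q`.
  set n := K * M 1
  have hn : 0 < n := by positivity
  set r := 2 + 2 * C / n
  set q := 2 * C + 1 / (η * n)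
  have hr : 0 < r := by positivity
  have hq : 0 < q := by positivity
  refine ⟨(r + q + 1) * K, by positivity, fun ω hω => ?_⟩
  have hMω := hMpos ω hω
  rw [abs_of_pos (by linarith : 0 < ω)]
  have hs : 1 ≤ ω ^ (1 - α) := Real.one_le_rpow hω (by linarith [hα.2])
  refine ContinuousLinearMap.opNorm_le_bound _ (by positivity) fun F => ?_
  have hX := (FracDamp.isResolventAt_resolventOp (hρ ω)).mem_graph F
  rw [FracDamp.fractionalOp_graph] at hX
  set X := FracDamp.resolventOp (FracDamp.fractionalOp B hα η) (Complex.I * (ω : ℂ)) F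
  -- The dual problem lives at frequency -ω; the hypothesis on 𝒜₀ is two-sided, so the bound is the
  -- same there.
  have hR := FracDamp.isResolventAt_resolventOp (hρ₀ (-ω))
  have hRN := hKM (-ω) (by rwa [abs_neg, abs_of_pos (by linarith : 0 < ω)])
  rw [abs_neg, abs_of_pos (by linarith : 0 < ω)] at hRN
  set N := K * M ω
  have hN : 0 < N := by positivity
  have hnN : n ≤ N := by
    have := hM (mem_Ici.2 zero_le_one) (mem_Ici.2 (by linarith : 0 ≤ ω)) hω
    exact mul_le_mul_of_nonneg_left this hK.le
  have h1 := FracDamp.norm_sq_add_norm_sq_le hN.le hX hR hRN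
  have h2 := hCb ω X F hω hX
  have h3 := FracDamp.gam_mul_integral_le hX
  have h4 := FracDamp.norm_energy_sq hα X
  -- The norm of φ needs no use of 𝒜₀: since ξ² + η ≥ η, it is controlled by the dissipation alone.
  have h5 : FracDamp.gam α * ∫ ξ : ℝ, ‖X.snd.snd ξ‖ ^ 2 ≤ ‖F‖ * ‖X‖ / η := by
    rw [le_div_iff₀ hη]
    refine le_trans ?_ h3
    rw [mul_assoc, ← integral_mul_const]
    refine mul_le_mul_of_nonneg_left ?_ (FracDamp.gam_pos hα).le
    refine integral_mono (((FracDamp.memLp_V hα X.snd.snd).integrable_norm_pow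
      two_ne_zero).mul_const η) (FracDamp.integrable_weight_mul_norm_sq
        (FracDamp.memLp_V hα X.snd.snd) hX.2.2.1) fun ξ => ?_
    simp only
    nlinarith [mul_nonneg (sq_nonneg |ξ|) (sq_nonneg ‖X.snd.snd ξ‖)]
  set s := ω ^ (1 - α)
  set T := N * s
  have hT : N ≤ T := le_mul_of_one_le_right hN.le hs
  have hnT : n ≤ T := hnN.trans hT
  have hT0 : 0 < T := hn.trans_le hnT
  have hquad : ‖X‖ ^ 2 ≤ r * (T * ‖F‖) ^ 2 + q * ((T * ‖F‖) * ‖X‖) := by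
    have t1 : ‖X‖ ^ 2 ≤ 2 * N ^ 2 * ‖F‖ ^ 2 + 2 * N * (C * (s * (‖F‖ * ‖X‖) + ‖F‖ ^ 2)) +
        ‖F‖ * ‖X‖ / η := by
      have := mul_le_mul_of_nonneg_left h2 (by positivity : 0 ≤ 2 * N)
      linarith
    have t2 : 2 * N ^ 2 * ‖F‖ ^ 2 ≤ 2 * T ^ 2 * ‖F‖ ^ 2 := by gcongr
    have t3 : N ≤ T ^ 2 / n := by
      rw [le_div_iff₀ hn, sq]
      exact mul_le_mul hT hnT hn.le hT0.le
    have t4 : 1 ≤ T / n := by rwa [le_div_iff₀ hn, one_mul]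
    calc ‖X‖ ^ 2 ≤ _ := t1
      _ = 2 * N ^ 2 * ‖F‖ ^ 2 + 2 * C * (T * (‖F‖ * ‖X‖)) + 2 * C * (N * ‖F‖ ^ 2) +
          1 * (‖F‖ * ‖X‖ / η) := by simp only [T]; ring
      _ ≤ 2 * T ^ 2 * ‖F‖ ^ 2 + 2 * C * (T * (‖F‖ * ‖X‖)) + 2 * C * (T ^ 2 / n * ‖F‖ ^ 2) +
          T / n * (‖F‖ * ‖X‖ / η) := by gcongr
      _ = _ := by simp only [r, q]; field_simp; ring
  have := FracDamp.le_mul_of_sq_le (by positivity) hr.le hq.le hquad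
  refine this.trans_eq ?_
  simp only [T, N]; ring
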